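/- **Setting.** Let $\mathcal W\subseteq\mathbb R^2$, and let $\mathcal O_i\subset\mathcal W$, $i\in\mathbb I=\{1,\dots,b\}$, be nonempty compact convex sets (obstacles), $\mathcal O_{\mathcal W}=\bigcup_i\mathcal O_i$. Let $r\ge 0$ and assume $d(\mathcal O_i,\mathcal O_j)>2r$ for all $i\neq j$. Put $\bar r_s=\min\{\tfrac12\min_{i\ne j}d(\mathcal O_i,\mathcal O_j)-r,\ d(\mathbf 0,\mathcal O_{\mathcal W})-r\}$ (the first entry is $+\infty$ if $b=1$), let $0<r_s<\bar r_s$, $r_a=r+r_s$, $0<\epsilon<\epsilon_s<\epsilon_d<\bar r_s-r_s$, $\gamma>0$ and $\mathbf s\in\mathbb R^2\setminus\{\mathbf 0\}$. Write $\mathcal D_y(A)=A\oplus\{\|\mathbf q\|\le y\}$ (Minkowski sum), $\mathcal W_{r_a}=\mathcal W\setminus\bigcup_i(\mathcal D_{r_a}(\mathcal O_i))^\circ$, and assume $\mathbf 0\in(\mathcal W_{r_a})^\circ$. Let $\Pi(\mathbf x,V)$ be the point of $V$ nearest to $\mathbf x$, $\nu_z(\mathbf p)=\begin{bmatrix}0&z\\-z&0\end{bmatrix}\mathbf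 p$ for $z\in\{-1,1\}$, $\mathcal L_>(\mathbf 0,\mathbf q)=\{\lambda\mathbf q:\lambda>0\}$, and let $\alpha_s(\mathbf p,\mathbf q)\in(-\pi,\pi]$ be the angle from $\mathbf p$ to $\mathbf q$, counter-clockwise positive. For each $i$ let $\mathcal T^i=\mathcal D_{r_a+\epsilon_d}(\mathcal O_i)\setminus(\mathcal D_{r_a}(\mathcal O_i))^\circ$ and - $\mathcal R_b^i=\{\mathbf q\in\mathcal T^i:\mathbf q^\top(\mathbf q-\Pi(\mathbf q,\mathcal O_i))\le 0\}$, - $\mathcal R_f^i$ (respectively $\mathcal{ER}_f^i$) the set of $\mathbf q\in\mathcal T^i$ such that the segment from $\mathbf q$ to $\mathbf 0$ meets $(\mathcal D_{r_a}(\mathcal O_i))^\circ$ (respectively $(\mathcal D_{r_a+\epsilon}(\mathcal O_i))^\circ$), - $\mathcal R_m^i=\{\mathbf q\in\mathcal T^i\setminus(\mathcal R_b^i\cup\mathcal R_f^i): m\,\alpha_s(\mathbf q,\mathbf q-\Pi(\mathbf q,\mathcal O_i))\in[-\pi/2,0]\}$ for $m\in\{-1,1\}$. The flow and jump sets are, for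 $m=0$, $$\mathcal F_0=\bigcap_i\Big[\big(\mathcal W_{r_a}\setminus(\mathcal D_{r_a+\epsilon_s}(\mathcal O_i))^\circ\big)\cup\mathcal R_{-1}^i\cup\mathcal R_1^i\cup\mathcal R_b^i\Big],\qquad \mathcal J_0=\bigcup_i\mathcal J_0^i,\quad \mathcal J_0^i=\mathcal D_{r_a+\epsilon_s}(\mathcal O_i)\cap\overline{\mathcal R_f^i},$$ and, for $m\in\{-1,1\}$, $$\mathcal F_m=\bigcup_i\Big[\mathcal R_m^i\cup\overline{\mathcal{ER}_f^i\setminus\mathcal R_b^i}\Big],\qquad \mathcal J_m=\bigcap_i\Big[\big(\mathcal W_{r_a}\setminus(\mathcal D_{r_a+\epsilon_d}(\mathcal O_i))^\circ\big)\cup\mathcal R_b^i\cup(\mathcal R_{-m}^i\setminus\mathcal{ER}_f^i)\Big].$$ Put $\mathbb M=\{-1,0,1\}$. The closed-loop hybrid system with state $\xi=(\mathbf x,m,k)$, $m\in\mathbb M$, $k\in\mathbb I$, flows when $\mathbf x\in\mathcal F_m$ according to $$\dot{\mathbf x}=-\gamma\kappa\,\mathbf x+\gamma(1-\kappa)\,\nu_m\!\left(\frac{\mathbf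 x-\Pi(\mathbf x,\mathcal O_{\mathcal W})}{\|\mathbf x-\Pi(\mathbf x,\mathcal O_{\mathcal W})\|}\right)\|\mathbf x\|,\qquad \dot m=0,\ \dot k=0,$$ where $\kappa=1+m^2\big[\eta(d(\mathbf x,\mathcal O_{\mathcal W})-r_a)-1\big]$ and $\eta(\varrho)$ equals $0$ for $\varrho\le\epsilon$, $1$ for $\varrho\ge\epsilon_s$, and $\frac{\varrho-\epsilon}{\epsilon_s-\epsilon}$ in between (for $m=0$ this reads $\dot{\mathbf x}=-\gamma\mathbf x$). It may jump when $\mathbf x\in\mathcal J_m$, with $\mathbf x^+=\mathbf x$ and: - if $m\in\{-1,1\}$: $m^+=0$, $k^+=k$; - if $m=0$: $k^+$ is any index with $\mathbf x\in\mathcal J_0^{k^+}$, and $m^+=1$ if $\mathbf x^\top\mathbf s>0$, $m^+=-1$ if $\mathbf x^\top\mathbf s<0$, $m^+\in\{-1,1\}$ if $\mathbf x^\top\mathbf s=0$. Solutions are hybrid arcs on hybrid time domains, locally absolutely continuous during flows; hybrid times are ordered by $(t,j)\preceq(t',j')$ iff $t<t'$, or $t=t'$ and $j\le j'$. **Lemma.**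 Let $\xi=(\mathbf x,m,k)$ be a solution of this system. If at some $(t_0,j_0)\in\operatorname{dom}\xi$ $$\xi(t_0,j_0)\in\big(\mathcal W_{r_a}\setminus\mathcal L_>(\mathbf 0,\nu_{-1}(\mathbf s))\big)\times\{0\}\times\mathbb I,$$ that is, the system is in the move-to-target mode $m=0$ and the robot is not on the open half-line $\mathcal L_>(\mathbf 0,\nu_{-1}(\mathbf s))$, then for all $(t,j)\in\operatorname{dom}\xi$ with $(t,j)\succeq(t_0,j_0)$ $$\xi(t,j)\notin\mathcal L_>(\mathbf 0,\nu_{-1}(\mathbf s))\times\mathbb M\times\mathbb I,$$ that is, $\mathbf x(t,j)$ is not on that half-line. -/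

import Mathlib

open scoped Pointwise

noncomputable section

namespace HybridNav

/-! ### Hybrid systems and their solutions -/

/-- A hybrid system: `ξ̇ ∈ flowMap ξ` for `ξ ∈ flowSet`, `ξ⁺ ∈ jumpMap ξ` for `ξ ∈ jumpSet`. -/
structure HybridSystem (E : Type*) where
  flowSet : Set E
  flowMap : E → Set E
  jumpSet : Set E
  jumpMap : E → Set E

/-- A hybrid time domain: the union of the sets `[t_j, t_{j+1}] × {j}` over an infinite sequence
`0 = t_0 ≤ t_1 ≤ ...`, or over a finite one, in which the last interval is either closed or of the
form `[t_J, T)` with `T` finite or `+∞`. -/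
def IsHybridTimeDomain (D : Set (ℝ × ℕ)) : Prop :=
  ∃ t : ℕ → ℝ, t 0 = 0 ∧ Monotone t ∧
    (D = {p | t p.2 ≤ p.1 ∧ p.1 ≤ t (p.2 + 1)} ∨
      (∃ J : ℕ, D = {p | p.2 ≤ J ∧ t p.2 ≤ p.1 ∧ p.1 ≤ t (p.2 + 1)}) ∨
      (∃ (J : ℕ) (T : EReal), ((t J : ℝ) : EReal) < T ∧
        D = {p | (p.2 < J ∧ t p.2 ≤ p.1 ∧ p.1 ≤ t (p.2 + 1)) ∨
          (p.2 = J ∧ t J ≤ p.1 ∧ ((p.1 : ℝ) : EReal) < T)}))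

/-- The set of ordinary times `t` such that `(t, j)` belongs to `D`. -/
def slice (D : Set (ℝ × ℕ)) (j : ℕ) : Set ℝ := {t | (t, j) ∈ D}

/-- The order on the points of a hybrid time domain. -/
def TimeLE (p q : ℝ × ℕ) : Prop := p.1 < q.1 ∨ (p.1 = q.1 ∧ p.2 ≤ q.2)

/-- `φ` with domain `D` is a (not necessarily maximal) solution of the hybrid system `H`.
The values of `φ` outside `D` are irrelevant. -/
structure IsSolution {E : Type*} [NormedAddCommGroup E] [NormedSpace ℝ E]
    (H : HybridSystem E) (D : Set (ℝ × ℕ)) (φ : ℝ × ℕ → E) : Prop where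
  timeDomain : IsHybridTimeDomain D
  absCont : ∀ (j : ℕ) (a b : ℝ), (a, j) ∈ D → (b, j) ∈ D →
    AbsolutelyContinuousOnInterval (fun t => φ (t, j)) a b
  initial : φ (0, 0) ∈ closure H.flowSet ∪ H.jumpSet
  flow_mem : ∀ j : ℕ, ∀ t ∈ interior (slice D j), φ (t, j) ∈ H.flowSet
  flow_deriv : ∀ j : ℕ, ∀ᵐ t : ℝ, t ∈ interior (slice D j) →
    ∃ v ∈ H.flowMap (φ (t, j)), HasDerivAt (fun τ => φ (τ, j)) v t
  jump : ∀ (t : ℝ) (j : ℕ), (t, j) ∈ D → (t, j + 1) ∈ D →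
    φ (t, j) ∈ H.jumpSet ∧ φ (t, j + 1) ∈ H.jumpMap (φ (t, j))

/-! ### Plane geometry -/

/-- The Euclidean plane. -/
abbrev Plane : Type := EuclideanSpace ℝ (Fin 2)

/-- The matrix `[[0, z], [-z, 0]]` applied to `p`: for `z = 1` the clockwise and for `z = -1` the
counter-clockwise rotation by a right angle. -/
def nu (z : ℝ) (p : Plane) : Plane := !₂[z * p 1, -z * p 0]

/-- The open half-line starting at `p` (excluded) in the direction `q`. -/
def openHalfLine (p q : Plane) : Set Plane := {x | ∃ l : ℝ, 0 < l ∧ x = p + l • q}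

/-- The angle in `(-π, π]` from `p` to `q`, counter-clockwise positive. -/
def signedAngle (p q : Plane) : ℝ :=
  haveI : Fact (Module.finrank ℝ Plane = 2) := ⟨by simp⟩
  ((EuclideanSpace.basisFun (Fin 2) ℝ).toBasis.orientation.oangle p q).toReal

/-- The dilation of `A` by `y`, the Minkowski sum of `A` and the closed ball of radius `y`. -/
def dilate (y : ℝ) (A : Set Plane) : Set Plane := A + Metric.closedBall (0 : Plane) y

/-- The distance between two nonempty compact sets. -/
def setDist (A B : Set Plane) : ℝ := sInf {δ | ∃ p ∈ A, ∃ q ∈ B, δ = ‖p - q‖}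

/-- The set of the points of `V` closest to `q`. -/
def projSet (q : Plane) (V : Set Plane) : Set Plane := {a ∈ V | ∀ b ∈ V, ‖q - a‖ ≤ ‖q - b‖}

/-- The projection of `q` on `V`: the point of `V` closest to `q` if there is exactly one, as for
closed convex nonempty `V`; one of the closest points if there are several. -/
def proj (q : Plane) (V : Set Plane) : Plane := Classical.epsilon fun a => a ∈ projSet q V

theorem proj_mem_projSet {q : Plane} {V : Set Plane} (hV : IsCompact V) (hne : V.Nonempty) :
    proj q V ∈ projSet q V := by
  obtain ⟨a, ha, hmin⟩ := hV.exists_isMinOn (f := fun a => ‖q - a‖) hne (by fun_prop)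
  exact Classical.epsilon_spec (p := fun a => a ∈ projSet q V) ⟨a, ha, fun b hb => hmin hb⟩

/-! ### Workspace, parameters and regions -/

/-- The data: workspace `W`, obstacles `O i`, robot radius `r`, safety distance `rs`, widths
`ε`, `εs`, `εd` of the neighbourhoods, gain `γ`, and the vector `s` of the switching strategy. -/
structure Setup (b : ℕ) where
  W : Set Plane
  O : Fin b → Set Plane
  r : ℝ
  rs : ℝ
  ε : ℝ
  εs : ℝ
  εd : ℝ
  γ : ℝ
  s : Plane

namespace Setup

variable {b : ℕ} (S : Setup b)

/-- The union of the obstacles. -/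
def OW : Set Plane := ⋃ i, S.O i

/-- The radius of the robot enlarged by the safety distance. -/
def ra : ℝ := S.r + S.rs

/-- The minimum separation between two obstacles is greater than `2 r`. -/
def Separated : Prop := ∀ i j, i ≠ j → 2 * S.r < setDist (S.O i) (S.O j)

/-- `y` is smaller than `min {r̄ / 2 - r, d(0, OW) - r}`, where `r̄` is the minimum of the distances
between two different obstacles (`+∞` if there is only one obstacle). -/
def LtMargin (y : ℝ) : Prop :=
  (∀ i j, i ≠ j → y < setDist (S.O i) (S.O j) / 2 - S.r) ∧ y < Metric.infDist 0 S.OW - S.r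

/-- The obstacle-free workspace eroded by `y`. -/
def Wy (y : ℝ) : Set Plane := S.W \ ⋃ i, interior (dilate y (S.O i))

/-- The standing assumptions on the data. -/
structure Standing : Prop where
  O_nonempty : ∀ i, (S.O i).Nonempty
  O_compact : ∀ i, IsCompact (S.O i)
  O_convex : ∀ i, Convex ℝ (S.O i)
  O_subset : ∀ i, S.O i ⊆ S.W
  r_nonneg : 0 ≤ S.r
  rs_pos : 0 < S.rs
  rs_lt : S.LtMargin S.rs
  target : (0 : Plane) ∈ interior (S.Wy S.ra)
  ε_pos : 0 < S.ε
  ε_lt : S.ε < S.εs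
  εs_lt : S.εs < S.εd
  εd_lt : S.LtMargin (S.rs + S.εd)
  γ_pos : 0 < S.γ
  s_ne : S.s ≠ 0

/-- The neighbourhood of the dilated obstacle `i`. -/
def tube (i : Fin b) : Set Plane :=
  dilate (S.ra + S.εd) (S.O i) \ interior (dilate S.ra (S.O i))

/-- The back region. -/
def backRegion (i : Fin b) : Set Plane :=
  {q ∈ S.tube i | inner ℝ q (q - proj q (S.O i)) ≤ 0}

/-- The points of the neighbourhood of obstacle `i` whose segment to the target meets the interior
of the obstacle dilated by `y`. -/
def shadow (y : ℝ) (i : Fin b) : Set Plane :=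
  {q ∈ S.tube i | (segment ℝ q 0 ∩ interior (dilate y (S.O i))).Nonempty}

/-- The front region. -/
def frontRegion (i : Fin b) : Set Plane := S.shadow S.ra i

/-- The enlarged front region. -/
def enlargedFrontRegion (i : Fin b) : Set Plane := S.shadow (S.ra + S.ε) i

/-- The side regions, for `m = 1` (angle in `[-π/2, 0]`) and `m = -1` (angle in `[0, π/2]`). -/
def sideRegion (m : ℝ) (i : Fin b) : Set Plane :=
  {q ∈ S.tube i \ (S.backRegion i ∪ S.frontRegion i) |
    m * signedAngle q (q - proj q (S.O i)) ∈ Set.Icc (-(Real.pi / 2)) 0}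

/-! ### Flow and jump sets -/

def J0i (i : Fin b) : Set Plane := dilate (S.ra + S.εs) (S.O i) ∩ closure (S.frontRegion i)

def F0i (i : Fin b) : Set Plane :=
  (S.Wy S.ra \ interior (dilate (S.ra + S.εs) (S.O i))) ∪
    S.sideRegion (-1) i ∪ S.sideRegion 1 i ∪ S.backRegion i

/-- The flow set of obstacle `i` in the obstacle-avoidance mode `m = 1` or `m = -1`. -/
def Fmi (m : ℝ) (i : Fin b) : Set Plane :=
  S.sideRegion m i ∪ closure (S.enlargedFrontRegion i \ S.backRegion i)

/-- The jump set of obstacle `i` in the obstacle-avoidance mode `m = 1` or `m = -1`. -/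
def Jmi (m : ℝ) (i : Fin b) : Set Plane :=
  (S.Wy S.ra \ interior (dilate (S.ra + S.εd) (S.O i))) ∪ S.backRegion i ∪
    (S.sideRegion (-m) i \ S.enlargedFrontRegion i)

open Classical in
/-- The flow set of the mode `m`. -/
def Fm (m : ℝ) : Set Plane := if m = 0 then ⋂ i, S.F0i i else ⋃ i, S.Fmi m i

open Classical in
/-- The jump set of the mode `m`. -/
def Jm (m : ℝ) : Set Plane := if m = 0 then ⋃ i, S.J0i i else ⋂ i, S.Jmi m i

/-! ### Control law and update laws -/

/-- The rotational vector. -/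
def v (x : Plane) (m : ℝ) : Plane :=
  nu m ((‖x‖ / ‖x - proj x S.OW‖) • (x - proj x S.OW))

/-- The proximity to the obstacles. -/
def rho (x : Plane) : ℝ := Metric.infDist x S.OW - S.ra

open Classical in
def eta (ρ : ℝ) : ℝ :=
  if S.εs ≤ ρ then 1 else if S.ε ≤ ρ then (ρ - S.ε) / (S.εs - S.ε) else 0

def kappa (x : Plane) (m : ℝ) : ℝ := 1 + m ^ 2 * (S.eta (S.rho x) - 1)

/-- The control input. -/
def u (x : Plane) (m : ℝ) : Plane :=
  -(S.γ * S.kappa x m) • x + (S.γ * (1 - S.kappa x m)) • S.v x m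

/-- The choice of the direction of motion on entering the obstacle-avoidance mode. -/
def M (x : Plane) : Set ℝ :=
  {z | (z = -1 ∧ inner ℝ x S.s ≤ 0) ∨ (z = 1 ∧ 0 ≤ inner ℝ x S.s)}

/-- The update law of the mode indicator. -/
def L (x : Plane) (m : ℝ) : Set ℝ := {z | (m = 0 ∧ z ∈ S.M x) ∨ (m ≠ 0 ∧ z = 0)}

/-! ### The closed loop -/

/-- The set of modes: `0` is move-to-target, `1` and `-1` are obstacle-avoidance. -/
def modes : Set ℝ := {-1, 0, 1}

/-- The number in `{1, ..., b}` of the obstacle `i`. -/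
def num (i : Fin b) : ℝ := (i : ℕ) + 1

/-- The index set `{1, ..., b}` of the obstacles. -/
def indices (b : ℕ) : Set ℝ := Set.range (num : Fin b → ℝ)

/-- The update law of the obstacle index, at the state `(x, m, k)`. -/
def N (x : Plane) (m k : ℝ) : Set ℝ :=
  {k' | (m = 0 ∧ ∃ i : Fin b, x ∈ S.J0i i ∧ k' = num i) ∨ (m ≠ 0 ∧ k' = k)}

/-- The hybrid closed-loop system with the state `(x, m, k)`. -/
def closedLoop : HybridSystem (Plane × ℝ × ℝ) where
  flowSet := {ξ | ξ.1 ∈ S.Fm ξ.2.1 ∧ ξ.2.1 ∈ modes ∧ ξ.2.2 ∈ indices b}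
  flowMap := fun ξ => {(S.u ξ.1 ξ.2.1, 0, 0)}
  jumpSet := {ξ | ξ.1 ∈ S.Jm ξ.2.1 ∧ ξ.2.1 ∈ modes ∧ ξ.2.2 ∈ indices b}
  jumpMap := fun ξ => {ξ' | ξ'.1 = ξ.1 ∧ ξ'.2.1 ∈ S.L ξ.1 ξ.2.1 ∧ ξ'.2.2 ∈ S.N ξ.1 ξ.2.1 ξ.2.2}

end Setup

end HybridNav

end

/-! ### Absolutely continuous functions -/

/-! In mode `0` the motion is radial, so the position never leaves its ray from the target. In a
mode `m ≠ 0` the velocity satisfies `m * cross x ẋ ≤ 0`: the radial part drops out, and the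
rotational part has the right sign because `⟪x, x - Π⟫ ≥ 0` off the back region, a closed condition
(`Standing.mul_cross_u_nonpos`). Moreover, one flow interval stays near a single obstacle, since the
tubes are closed and pairwise disjoint, and each tube lies in an open half-plane bounded by a line
through the target. The total turn is therefore less than `π`, and its sense can be read off the end
points (`mul_cross_position_nonpos`).

The switching rule enters with `m * ⟪x, s⟫ ≥ 0`, and `cross x (nu (-1) s) = ⟪x, s⟫`. Reaching the
half-line would force `m * ⟪x, s⟫ ≤ 0` at the start of the interval, hence equality. Start and end
would then lie on the same ray, so the motion would have started on the half-line. Jumps preserve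
the position and restore the sign condition, and induction on the jump count concludes. -/

theorem LipschitzOnWith.comp_absolutelyContinuousOnInterval {X Y : Type*} [PseudoMetricSpace X]
    [PseudoMetricSpace Y] {g : X → Y} {K : NNReal} {s : Set X} {f : ℝ → X} {a b : ℝ}
    (hg : LipschitzOnWith K g s) (hf : AbsolutelyContinuousOnInterval f a b)
    (hs : Set.MapsTo f (Set.uIcc a b) s) :
    AbsolutelyContinuousOnInterval (fun t => g (f t)) a b := by
  rw [absolutelyContinuousOnInterval_iff] at hf ⊢
  intro ε hε
  -- `K + 1` rather than `K`, since `K` may be zero.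
  obtain ⟨δ, hδ, H⟩ := hf (ε / (K + 1)) (by positivity)
  refine ⟨δ, hδ, fun E hE hlen => ?_⟩
  have h := H E hE hlen
  calc ∑ i ∈ Finset.range E.1, dist (g (f (E.2 i).1)) (g (f (E.2 i).2))
      ≤ ∑ i ∈ Finset.range E.1, K * dist (f (E.2 i).1) (f (E.2 i).2) :=
        Finset.sum_le_sum fun i hi =>
          hg.dist_le_mul _ (hs (hE.1 i hi).1) _ (hs (hE.1 i hi).2)
    _ = K * ∑ i ∈ Finset.range E.1, dist (f (E.2 i).1) (f (E.2 i).2) := by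
        rw [Finset.mul_sum]
    _ ≤ K * (ε / (K + 1)) := by gcongr
    _ < ε := by
        rw [mul_div_assoc', div_lt_iff₀ (by positivity)]
        nlinarith

theorem LipschitzWith.comp_absolutelyContinuousOnInterval {X Y : Type*} [PseudoMetricSpace X]
    [PseudoMetricSpace Y] {g : X → Y} {K : NNReal} {f : ℝ → X} {a b : ℝ}
    (hg : LipschitzWith K g) (hf : AbsolutelyContinuousOnInterval f a b) :
    AbsolutelyContinuousOnInterval (fun t => g (f t)) a b :=
  (hg.lipschitzOnWith (s := Set.univ)).comp_absolutelyContinuousOnInterval hf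
    fun _ _ => Set.mem_univ _

namespace AbsolutelyContinuousOnInterval

theorem inv_of_pos {f : ℝ → ℝ} {a b : ℝ} (hf : AbsolutelyContinuousOnInterval f a b)
    (hpos : ∀ t ∈ Set.uIcc a b, 0 < f t) :
    AbsolutelyContinuousOnInterval (fun t => (f t)⁻¹) a b := by
  obtain ⟨c, hc, hmin⟩ := isCompact_uIcc.exists_isMinOn Set.nonempty_uIcc hf.continuousOn
  have hδ := hpos c hc
  have hlip : LipschitzOnWith (Real.toNNReal ((f c)⁻¹ * (f c)⁻¹)) (fun y : ℝ => y⁻¹)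
      (Set.Ici (f c)) := by
    refine LipschitzOnWith.of_dist_le_mul fun x hx y hy => ?_
    have hx0 : 0 < x := hδ.trans_le hx
    have hy0 : 0 < y := hδ.trans_le hy
    rw [Real.coe_toNNReal _ (by positivity), Real.dist_eq, Real.dist_eq,
      inv_sub_inv hx0.ne' hy0.ne', abs_div, abs_of_pos (mul_pos hx0 hy0), abs_sub_comm,
      div_eq_inv_mul, mul_inv]
    have h1 : x⁻¹ ≤ (f c)⁻¹ := inv_anti₀ hδ hx
    have h2 : y⁻¹ ≤ (f c)⁻¹ := inv_anti₀ hδ hy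
    gcongr
  exact hlip.comp_absolutelyContinuousOnInterval hf fun t ht => hmin ht

/-- Flows have a derivative only almost everywhere, so monotonicity comes from the fundamental
theorem of calculus for absolutely continuous functions, not from the mean value theorem. -/
theorem le_of_ae_hasDerivAt_nonpos {f : ℝ → ℝ} {a b : ℝ} (hab : a ≤ b)
    (hf : AbsolutelyContinuousOnInterval f a b)
    (hd : ∀ᵐ t, t ∈ Set.Ioo a b → ∃ v ≤ 0, HasDerivAt f v t) : f b ≤ f a := by
  have h := hf.integral_deriv_eq_sub
  rw [intervalIntegral.integral_of_le hab, MeasureTheory.integral_Ioc_eq_integral_Ioo] at h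
  have : ∫ t in Set.Ioo a b, deriv f t ≤ 0 := by
    refine MeasureTheory.setIntegral_nonpos_of_ae_restrict ?_
    rw [Filter.EventuallyLE, MeasureTheory.ae_restrict_iff' measurableSet_Ioo]
    filter_upwards [hd] with t ht hm
    obtain ⟨v, hv, hdv⟩ := ht hm
    simpa [hdv.deriv] using hv
  linarith

theorem eq_of_ae_hasDerivAt_zero {f : ℝ → ℝ} {a b : ℝ} (hab : a ≤ b)
    (hf : AbsolutelyContinuousOnInterval f a b)
    (hd : ∀ᵐ t, t ∈ Set.Ioo a b → HasDerivAt f 0 t) : f b = f a := by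
  refine le_antisymm (hf.le_of_ae_hasDerivAt_nonpos hab ?_) ?_
  · filter_upwards [hd] with t ht hm using ⟨0, le_rfl, ht hm⟩
  · have := hf.fun_neg.le_of_ae_hasDerivAt_nonpos hab (by
      filter_upwards [hd] with t ht hm using ⟨-0, by simp, (ht hm).fun_neg⟩)
    linarith

end AbsolutelyContinuousOnInterval

namespace HybridNav

/-! ### Hybrid time domains -/

/-- The common end point of two consecutive intervals; it drives the induction on the jump count. -/
theorem IsHybridTimeDomain.exists_jumpTime {D : Set (ℝ × ℕ)} (hD : IsHybridTimeDomain D)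
    {t : ℝ} {j : ℕ} (h : (t, j + 1) ∈ D) :
    ∃ s ≤ t, (s, j) ∈ D ∧ (s, j + 1) ∈ D ∧ ∀ t', (t', j) ∈ D → t' ≤ s := by
  obtain ⟨τ, -, hτ, hD⟩ := hD
  have hs : ∀ j, τ j ≤ τ (j + 1) := fun j => hτ (Nat.le_succ j)
  rcases hD with rfl | ⟨J, rfl⟩ | ⟨J, T, hT, rfl⟩
  · exact ⟨τ (j + 1), h.1, ⟨hs j, le_rfl⟩, ⟨le_rfl, hs _⟩, fun t' ht' => ht'.2⟩
  · exact ⟨τ (j + 1), h.2.1, ⟨(Nat.le_succ j).trans h.1, hs j, le_rfl⟩, ⟨h.1, le_rfl, hs _⟩,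
      fun t' ht' => ht'.2.2⟩
  · have hj : j + 1 ≤ J := h.elim (fun h => h.1.le) fun h => h.1.le
    refine ⟨τ (j + 1), ?_, Or.inl ⟨hj, hs j, le_rfl⟩, ?_, fun t' ht' => ?_⟩
    · exact h.elim (fun h => h.2.1) fun h => (congrArg τ h.1).trans_le h.2.1
    · rcases h with h | h
      · exact Or.inl ⟨h.1, le_rfl, hs _⟩
      -- The last interval contains its left end because `τ J < T`.
      · have h1 : j + 1 = J := h.1
        exact Or.inr ⟨h1, h1 ▸ le_rfl, h1 ▸ hT⟩
    · exact ht'.elim (fun h => h.2.2) fun h => absurd h.1 (Nat.ne_of_lt hj)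

theorem IsHybridTimeDomain.ordConnected_slice {D : Set (ℝ × ℕ)} (hD : IsHybridTimeDomain D)
    (j : ℕ) : (slice D j).OrdConnected := by
  refine ⟨fun x hx y hy z hz => ?_⟩
  obtain ⟨τ, -, hτ, hD⟩ := hD
  rcases hD with rfl | ⟨J, rfl⟩ | ⟨J, T, hT, rfl⟩
  · exact ⟨hx.1.trans hz.1, hz.2.trans hy.2⟩
  · exact ⟨hx.1, hx.2.1.trans hz.1, hz.2.trans hy.2.2⟩
  · rcases hx with hx | hx
    · rcases hy with hy | hy
      · exact Or.inl ⟨hx.1, hx.2.1.trans hz.1, hz.2.trans hy.2.2⟩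
      · exact absurd hy.1 hx.1.ne
    · rcases hy with hy | hy
      · exact absurd hx.1 hy.1.ne
      · exact Or.inr ⟨hx.1, hx.2.1.trans hz.1,
          lt_of_le_of_lt (EReal.coe_le_coe_iff.2 hz.2) hy.2.2⟩

theorem IsHybridTimeDomain.le_of_lt {D : Set (ℝ × ℕ)} (hD : IsHybridTimeDomain D) {t t' : ℝ}
    {i j : ℕ} (hij : i < j) (ht : (t, i) ∈ D) (ht' : (t', j) ∈ D) : t ≤ t' := by
  induction j generalizing t' with
  | zero => omega
  | succ j ih =>
    obtain ⟨s, hs, hsj, -, hmax⟩ := hD.exists_jumpTime ht'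
    rcases (Nat.lt_succ_iff.1 hij).lt_or_eq with h | rfl
    · exact (ih h hsj).trans hs
    · exact (hmax t ht).trans hs

theorem IsHybridTimeDomain.Ioo_subset {D : Set (ℝ × ℕ)} (hD : IsHybridTimeDomain D) {j : ℕ}
    {a c : ℝ} (ha : (a, j) ∈ D) (hc : (c, j) ∈ D) : Set.Ioo a c ⊆ interior (slice D j) :=
  interior_maximal (Set.Ioo_subset_Icc_self.trans ((hD.ordConnected_slice j).out ha hc)) isOpen_Ioo

/-! ### The plane -/

/-- The cross product of two vectors of the plane. -/
def cross (p q : Plane) : ℝ := p 0 * q 1 - p 1 * q 0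

theorem inner_eq (p q : Plane) : inner ℝ p q = p 0 * q 0 + p 1 * q 1 := by
  simp [PiLp.inner_apply, Fin.sum_univ_two]; ring

theorem cross_nu (z : ℝ) (p q : Plane) : cross p (nu z q) = -z * inner ℝ p q := by
  simp [cross, nu, inner_eq]; ring

/-! ### Projections on convex sets -/

theorem inner_le_zero_of_mem_projSet {q a w : Plane} {V : Set Plane} (hV : Convex ℝ V)
    (ha : a ∈ projSet q V) (hw : w ∈ V) : inner ℝ (q - a) (w - a) ≤ 0 := by
  refine (norm_eq_iInf_iff_real_inner_le_zero hV ha.1).1 ?_ w hw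
  have : Nonempty V := ⟨⟨a, ha.1⟩⟩
  refine le_antisymm (le_ciInf fun w => ha.2 w w.2) ?_
  exact ciInf_le ⟨0, by rintro _ ⟨w, rfl⟩; exact norm_nonneg _⟩ (⟨a, ha.1⟩ : V)

/-- Add the variational inequalities at `a` and `a'`, then apply Cauchy–Schwarz. The case `q = q'`
gives uniqueness of the nearest point. -/
theorem norm_sub_le_of_mem_projSet {q q' a a' : Plane} {V : Set Plane} (hV : Convex ℝ V)
    (ha : a ∈ projSet q V) (ha' : a' ∈ projSet q' V) : ‖a - a'‖ ≤ ‖q - q'‖ := by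
  have h1 := inner_le_zero_of_mem_projSet hV ha ha'.1
  have h2 := inner_le_zero_of_mem_projSet hV ha' ha.1
  have h3 : inner ℝ (a - a') (a - a') ≤ inner ℝ (q - q') (a - a') := by
    simp only [inner_eq, PiLp.sub_apply] at *
    linarith
  rw [real_inner_self_eq_norm_mul_norm] at h3
  have h4 := h3.trans (real_inner_le_norm _ _)
  by_contra! h
  have h5 : 0 < ‖a - a'‖ := (norm_nonneg _).trans_lt h
  exact absurd (le_of_mul_le_mul_right h4 h5) h.not_ge

theorem lipschitzWith_proj {V : Set Plane} (hV : Convex ℝ V) (hc : IsCompact V)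
    (hne : V.Nonempty) : LipschitzWith 1 fun q => proj q V :=
  LipschitzWith.of_dist_le_mul fun q q' => by
    simpa [dist_eq_norm] using norm_sub_le_of_mem_projSet hV (proj_mem_projSet hc hne)
      (proj_mem_projSet hc hne)

namespace Setup

variable {b : ℕ} {S : Setup b}

theorem Standing.isCompact_OW (hS : S.Standing) : IsCompact S.OW :=
  isCompact_iUnion hS.O_compact

theorem exists_of_mem_dilate {y : ℝ} {A : Set Plane} {x : Plane} (hx : x ∈ dilate y A) :
    ∃ w ∈ A, ‖x - w‖ ≤ y := by
  obtain ⟨w, hw, z, hz, rfl⟩ := hx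
  exact ⟨w, hw, by simpa using hz⟩

theorem Standing.isClosed_tube (hS : S.Standing) (i : Fin b) : IsClosed (S.tube i) :=
  (((hS.O_compact i).add (isCompact_closedBall _ _)).isClosed).sdiff isOpen_interior

theorem setDist_le {A B : Set Plane} {p q : Plane} (hp : p ∈ A) (hq : q ∈ B) :
    setDist A B ≤ ‖p - q‖ :=
  csInf_le ⟨0, by rintro _ ⟨p, -, q, -, rfl⟩; exact norm_nonneg _⟩ ⟨p, hp, q, hq, rfl⟩

theorem Standing.lt_norm_sub (hS : S.Standing) {i j : Fin b} (hij : i ≠ j) {p q : Plane}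
    (hp : p ∈ S.O i) (hq : q ∈ S.O j) : 2 * (S.ra + S.εd) < ‖p - q‖ := by
  have h1 := hS.εd_lt.1 i j hij
  have h2 := setDist_le hp hq
  unfold ra
  linarith

theorem Standing.tube_unique (hS : S.Standing) {i j : Fin b} {x : Plane} (hi : x ∈ S.tube i)
    (hj : x ∈ S.tube j) : i = j := by
  by_contra hij
  obtain ⟨p, hp, hpx⟩ := exists_of_mem_dilate hi.1
  obtain ⟨q, hq, hqx⟩ := exists_of_mem_dilate hj.1
  have h := hS.lt_norm_sub hij hp hq
  have h2 := norm_sub_le_norm_sub_add_norm_sub p x q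
  rw [norm_sub_rev p x] at h2
  linarith

/-- The control law projects on the nonconvex union, the regions on one obstacle. The separation of
the obstacles makes the two agree in a tube. -/
theorem Standing.proj_OW (hS : S.Standing) {i : Fin b} {x : Plane} (hi : x ∈ S.tube i) :
    proj x S.OW = proj x (S.O i) := by
  obtain ⟨p, hp, hpx⟩ := exists_of_mem_dilate hi.1
  have h := proj_mem_projSet (q := x) hS.isCompact_OW ⟨p, Set.mem_iUnion.2 ⟨i, hp⟩⟩
  obtain ⟨j, hj⟩ := Set.mem_iUnion.1 h.1
  have hle := h.2 p (Set.mem_iUnion.2 ⟨i, hp⟩)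
  have hij : i = j := by
    by_contra hij
    have h1 := hS.lt_norm_sub hij hp hj
    have h2 := norm_sub_le_norm_sub_add_norm_sub p x (proj x S.OW)
    rw [norm_sub_rev p x] at h2
    linarith
  subst hij
  have h' : proj x S.OW ∈ projSet x (S.O i) :=
    ⟨hj, fun w hw => h.2 w (Set.mem_iUnion.2 ⟨i, hw⟩)⟩
  have := norm_sub_le_of_mem_projSet (hS.O_convex i) h'
    (proj_mem_projSet (q := x) (hS.O_compact i) (hS.O_nonempty i))
  rw [sub_self, norm_zero] at this
  exact sub_eq_zero.1 (norm_le_zero_iff.1 this)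

/-- The neighbourhood of an obstacle lies in an open half-plane with the target on its boundary. -/
theorem Standing.exists_inner_pos (hS : S.Standing) (i : Fin b) :
    ∃ a : Plane, ∀ x ∈ S.tube i, 0 < inner ℝ a x := by
  have hp := proj_mem_projSet (q := 0) (hS.O_compact i) (hS.O_nonempty i)
  set p := proj 0 (S.O i)
  -- The obstacle lies in `⟪p, w⟫ ≥ ‖p‖ ^ 2`, and a displacement by at most `ra + εd < ‖p‖` keeps
  -- the product positive.
  refine ⟨p, fun x hx => ?_⟩
  obtain ⟨w, hw, hwx⟩ := exists_of_mem_dilate hx.1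
  have h1 := inner_le_zero_of_mem_projSet (hS.O_convex i) hp hw
  have h2 : Metric.infDist 0 S.OW ≤ ‖p‖ := by
    have hmem : p ∈ S.OW := Set.mem_iUnion.2 ⟨i, hp.1⟩
    simpa using Metric.infDist_le_dist_of_mem (x := (0 : Plane)) hmem
  have h3 := hS.εd_lt.2
  have h4 : S.ra + S.εd < ‖p‖ := by unfold ra; linarith
  have h5 : inner ℝ p (w - x) ≤ ‖p‖ * ‖x - w‖ := by
    rw [norm_sub_rev]; exact real_inner_le_norm _ _
  have h6 : 0 < ‖p‖ := (norm_nonneg _).trans_lt (hwx.trans_lt h4)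
  have h7 : ‖p‖ * ‖x - w‖ < ‖p‖ * ‖p‖ := mul_lt_mul_of_pos_left (hwx.trans_lt h4) h6
  rw [← real_inner_self_eq_norm_mul_norm] at h7
  simp only [inner_eq, PiLp.sub_apply, PiLp.zero_apply] at *
  linarith

/-- The projection is continuous, so the non-strict inequality valid off the back region survives
the closure in `Fmi`. -/
theorem Standing.Fmi_subset (hS : S.Standing) (m : ℝ) (i : Fin b) :
    S.Fmi m i ⊆ {x | x ∈ S.tube i ∧ 0 ≤ inner ℝ x (x - proj x (S.O i))} := by
  have hcl : IsClosed {x | x ∈ S.tube i ∧ 0 ≤ inner ℝ x (x - proj x (S.O i))} := by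
    have hc := (lipschitzWith_proj (hS.O_convex i) (hS.O_compact i) (hS.O_nonempty i)).continuous
    have hin : Continuous fun x : Plane => inner ℝ x (x - proj x (S.O i)) :=
      continuous_id.inner (continuous_id.sub hc)
    exact (hS.isClosed_tube i).inter (isClosed_le continuous_const hin)
  have hmem : ∀ x ∈ S.tube i, x ∉ S.backRegion i → 0 ≤ inner ℝ x (x - proj x (S.O i)) :=
    fun x hx hb => le_of_not_ge fun h => hb ⟨hx, h⟩
  rintro x (hx | hx)
  · exact ⟨hx.1.1, hmem x hx.1.1 fun h => hx.1.2 (Or.inl h)⟩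
  · refine closure_minimal ?_ hcl hx
    exact fun y hy => ⟨hy.1.1, hmem y hy.1.1 hy.2⟩

theorem Standing.eta_le_one (hS : S.Standing) (ρ : ℝ) : S.eta ρ ≤ 1 := by
  have := hS.ε_lt
  unfold eta
  split_ifs with h1 h2
  · rfl
  · rw [div_le_one (by linarith)]; linarith
  · exact zero_le_one

/-- In the mode `m` the control input never turns against the sense of `m`. -/
theorem Standing.mul_cross_u_nonpos (hS : S.Standing) {i : Fin b} {x : Plane} {m : ℝ}
    (hx : x ∈ S.Fmi m i) : m * cross x (S.u x m) ≤ 0 := by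
  obtain ⟨ht, hn⟩ := hS.Fmi_subset m i hx
  rw [← hS.proj_OW ht] at hn
  -- The radial term of the control is parallel to `x`.
  have h1 : cross x (S.u x m) = S.γ * (1 - S.kappa x m) * cross x (S.v x m) := by
    simp [cross, u]; ring
  have h2 : cross x (S.v x m) = -m * (‖x‖ / ‖x - proj x S.OW‖ * inner ℝ x (x - proj x S.OW)) := by
    rw [v, cross_nu, inner_smul_right]
  have h3 : 0 ≤ 1 - S.kappa x m := by
    have := mul_nonneg (sq_nonneg m) (sub_nonneg.2 (hS.eta_le_one (S.rho x)))
    unfold kappa; linarith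
  rw [h1, h2]
  have := hS.γ_pos
  have : 0 ≤ S.γ * (1 - S.kappa x m) * (m * m) *
      (‖x‖ / ‖x - proj x S.OW‖ * inner ℝ x (x - proj x S.OW)) := by
    have := mul_self_nonneg m
    positivity
  linarith

/-! ### Solutions of the closed loop -/

variable {D : Set (ℝ × ℕ)} {ξ : ℝ × ℕ → Plane × ℝ × ℝ}

theorem absolutelyContinuous_mode (hξ : IsSolution S.closedLoop D ξ) {j : ℕ} {a c : ℝ}
    (ha : (a, j) ∈ D) (hc : (c, j) ∈ D) :
    AbsolutelyContinuousOnInterval (fun t => (ξ (t, j)).2.1) a c :=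
  LipschitzWith.prod_fst.comp_absolutelyContinuousOnInterval
    (LipschitzWith.prod_snd.comp_absolutelyContinuousOnInterval (hξ.absCont j a c ha hc))

theorem absolutelyContinuous_position (hξ : IsSolution S.closedLoop D ξ) {j : ℕ} {a c : ℝ}
    (ha : (a, j) ∈ D) (hc : (c, j) ∈ D) :
    AbsolutelyContinuousOnInterval (fun t => (ξ (t, j)).1) a c :=
  LipschitzWith.prod_fst.comp_absolutelyContinuousOnInterval (hξ.absCont j a c ha hc)

theorem ae_hasDerivAt (hξ : IsSolution S.closedLoop D ξ) {j : ℕ} {a c : ℝ}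
    (ha : (a, j) ∈ D) (hc : (c, j) ∈ D) :
    ∀ᵐ t, t ∈ Set.Ioo a c →
      HasDerivAt (fun t => (ξ (t, j)).1) (S.u (ξ (t, j)).1 (ξ (t, j)).2.1) t ∧
      HasDerivAt (fun t => (ξ (t, j)).2.1) 0 t := by
  filter_upwards [hξ.flow_deriv j] with t ht hm
  obtain ⟨v, hv, hd⟩ := ht (hξ.timeDomain.Ioo_subset ha hc hm)
  obtain rfl : v = _ := hv
  exact ⟨hd.fst, hd.snd.fst⟩

theorem mode_const (hξ : IsSolution S.closedLoop D ξ) {j : ℕ} {a c : ℝ}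
    (ha : (a, j) ∈ D) (hc : (c, j) ∈ D) (hac : a ≤ c) :
    (ξ (c, j)).2.1 = (ξ (a, j)).2.1 := by
  refine (absolutelyContinuous_mode hξ ha hc).eq_of_ae_hasDerivAt_zero hac ?_
  filter_upwards [ae_hasDerivAt hξ ha hc] with t ht hm using (ht hm).2

theorem mode_eq_of_mem_Icc (hξ : IsSolution S.closedLoop D ξ) {j : ℕ} {a c : ℝ}
    (ha : (a, j) ∈ D) (hc : (c, j) ∈ D) {t : ℝ} (ht : t ∈ Set.Icc a c) :
    (ξ (t, j)).2.1 = (ξ (a, j)).2.1 :=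
  mode_const hξ ha ((hξ.timeDomain.ordConnected_slice j).out ha hc ht) ht.1

/-- Here `ẋ = -γ x`, so `exp (γ t) • x` has zero derivative almost everywhere. -/
theorem position_of_mode_zero (hξ : IsSolution S.closedLoop D ξ) {j : ℕ} {a c : ℝ}
    (ha : (a, j) ∈ D) (hc : (c, j) ∈ D) (hac : a ≤ c) (hm : (ξ (a, j)).2.1 = 0) :
    Real.exp (S.γ * c) • (ξ (c, j)).1 = Real.exp (S.γ * a) • (ξ (a, j)).1 := by
  ext i
  have hx := ((EuclideanSpace.proj (𝕜 := ℝ) i).lipschitz).comp_absolutelyContinuousOnInterval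
    (absolutelyContinuous_position hξ ha hc)
  have he : AbsolutelyContinuousOnInterval (fun t => Real.exp (S.γ * t)) a c :=
    ContDiffOn.absolutelyContinuousOnInterval (by fun_prop)
  refine (he.fun_mul hx).eq_of_ae_hasDerivAt_zero hac ?_
  filter_upwards [ae_hasDerivAt hξ ha hc] with t ht hmem
  have h1 := (ht hmem).1
  rw [mode_eq_of_mem_Icc hξ ha hc (Set.Ioo_subset_Icc_self hmem), hm] at h1
  have h2 := (EuclideanSpace.proj (𝕜 := ℝ) i).hasFDerivAt.comp_hasDerivAt t h1
  have h3 : HasDerivAt (fun t => Real.exp (S.γ * t)) (Real.exp (S.γ * t) * (S.γ * 1)) t :=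
    ((hasDerivAt_id t).const_mul S.γ).exp
  refine (h3.fun_mul h2).congr_deriv ?_
  simp [u, kappa]
  ring

/-- In an obstacle-avoidance mode the robot remains in the neighbourhood of one obstacle. -/
theorem exists_mem_Fmi (hS : S.Standing) (hξ : IsSolution S.closedLoop D ξ) {j : ℕ} {a c : ℝ}
    (ha : (a, j) ∈ D) (hc : (c, j) ∈ D) (hac : a < c) (hm : (ξ (a, j)).2.1 ≠ 0) :
    ∃ i, (∀ t ∈ Set.Ioo a c, (ξ (t, j)).1 ∈ S.Fmi (ξ (a, j)).2.1 i) ∧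
      ∀ t ∈ Set.Icc a c, (ξ (t, j)).1 ∈ S.tube i := by
  set m := (ξ (a, j)).2.1
  have hex : ∀ t ∈ Set.Ioo a c, ∃ i, (ξ (t, j)).1 ∈ S.Fmi m i := by
    intro t ht
    have h := (hξ.flow_mem j t (hξ.timeDomain.Ioo_subset ha hc ht)).1
    rw [mode_eq_of_mem_Icc hξ ha hc (Set.Ioo_subset_Icc_self ht), Fm, if_neg hm] at h
    exact Set.mem_iUnion.1 h
  have htube : ∀ {t i}, (ξ (t, j)).1 ∈ S.Fmi m i → (ξ (t, j)).1 ∈ S.tube i :=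
    fun h => (hS.Fmi_subset m _ h).1
  have hcont : ContinuousOn (fun t => (ξ (t, j)).1) (Set.Icc a c) := by
    simpa [Set.uIcc_of_le hac.le] using (absolutelyContinuous_position hξ ha hc).continuousOn
  obtain ⟨t₁, ht₁⟩ := Set.nonempty_Ioo.2 hac
  obtain ⟨i, hi⟩ := hex t₁ ht₁
  have hsub : (fun t => (ξ (t, j)).1) '' Set.Ioo a c ⊆ S.tube i := by
    have hpre := (isPreconnected_Ioo (a := a) (b := c)).image _
      (hcont.mono Set.Ioo_subset_Icc_self)
    have hcl : IsClosed (⋃ k ∈ {k | k ≠ i}, S.tube k) :=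
      Set.Finite.isClosed_biUnion (Set.toFinite _) fun k _ => hS.isClosed_tube k
    -- The connected trajectory is covered by two disjoint closed sets, tube `i` and the finite
    -- union of the other tubes, and it meets the first.
    refine (isPreconnected_iff_subset_of_disjoint_closed.1 hpre _ _ (hS.isClosed_tube i) hcl
      ?_ ?_).resolve_right fun h => ?_
    · rintro _ ⟨t, ht, rfl⟩
      obtain ⟨k, hk⟩ := hex t ht
      by_cases hki : k = i
      · exact Or.inl (hki ▸ htube hk)
      · exact Or.inr (Set.mem_biUnion hki (htube hk))
    · rw [Set.eq_empty_iff_forall_notMem]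
      rintro x ⟨-, hx, hx'⟩
      obtain ⟨k, hk, hxk⟩ := Set.mem_iUnion₂.1 hx'
      exact hk (hS.tube_unique hxk hx)
    · obtain ⟨k, hk, hxk⟩ := Set.mem_iUnion₂.1 (h ⟨t₁, ht₁, rfl⟩)
      exact hk (hS.tube_unique hxk (htube hi))
  refine ⟨i, fun t ht => ?_, fun t ht => ?_⟩
  · obtain ⟨k, hk⟩ := hex t ht
    rwa [← hS.tube_unique (htube hk) (hsub ⟨t, ht, rfl⟩)]
  -- The flow condition holds only in the interior of the interval; the end points are reached by
  -- closedness of the tube.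
  · rw [← closure_Ioo hac.ne] at hcont ht
    exact closure_minimal hsub (hS.isClosed_tube i) (hcont.image_closure ⟨t, ht, rfl⟩)

/-- In the half-plane `⟪p, x⟫ > 0` the quotient `cross p x / ⟪p, x⟫` is the tangent of the angle
from `p` to `x`. Multiplied by `m`, it is nonincreasing along the flow. The vector `p` is kept in
the conclusion to exclude opposite end points later. -/
theorem mul_cross_position_nonpos (hS : S.Standing) (hξ : IsSolution S.closedLoop D ξ) {j : ℕ}
    {a c : ℝ} (ha : (a, j) ∈ D) (hc : (c, j) ∈ D) (hac : a < c) (hm : (ξ (a, j)).2.1 ≠ 0) :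
    (ξ (a, j)).2.1 * cross (ξ (a, j)).1 (ξ (c, j)).1 ≤ 0 ∧
      ∃ p : Plane, 0 < inner ℝ p (ξ (a, j)).1 ∧ 0 < inner ℝ p (ξ (c, j)).1 := by
  obtain ⟨i, hF, hT⟩ := exists_mem_Fmi hS hξ ha hc hac hm
  obtain ⟨p, hp⟩ := hS.exists_inner_pos i
  have hpa := hp _ (hT a (Set.left_mem_Icc.2 hac.le))
  have hpc := hp _ (hT c (Set.right_mem_Icc.2 hac.le))
  refine ⟨?_, p, hpa, hpc⟩
  set m := (ξ (a, j)).2.1 with hmdef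
  set x := fun t => (ξ (t, j)).1 with hx
  have hcoord : ∀ k, AbsolutelyContinuousOnInterval (fun t => x t k) a c := fun k =>
    ((EuclideanSpace.proj (𝕜 := ℝ) k).lipschitz).comp_absolutelyContinuousOnInterval
      (absolutelyContinuous_position hξ ha hc)
  have hnum : AbsolutelyContinuousOnInterval (fun t => m * cross p (x t)) a c :=
    (((hcoord 1).const_mul (p 0)).fun_sub ((hcoord 0).const_mul (p 1))).const_mul m
  have hden : AbsolutelyContinuousOnInterval (fun t => inner ℝ p (x t)) a c := by
    simp only [inner_eq]
    exact ((hcoord 0).const_mul (p 0)).fun_add ((hcoord 1).const_mul (p 1))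
  have hpos : ∀ t ∈ Set.uIcc a c, 0 < inner ℝ p (x t) := fun t ht =>
    hp _ (hT t (by rwa [Set.uIcc_of_le hac.le] at ht))
  have key := (hnum.fun_mul (hden.inv_of_pos hpos)).le_of_ae_hasDerivAt_nonpos hac.le (by
    filter_upwards [ae_hasDerivAt hξ ha hc] with t ht hmem
    have htI := Set.Ioo_subset_Icc_self hmem
    have h1 := (ht hmem).1
    rw [mode_eq_of_mem_Icc hξ ha hc htI, ← hmdef] at h1
    have hk : ∀ k, HasDerivAt (fun t => x t k) (S.u (x t) m k) t := fun k =>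
      (EuclideanSpace.proj (𝕜 := ℝ) k).hasFDerivAt.comp_hasDerivAt t h1
    have hn : HasDerivAt (fun t => m * cross p (x t)) (m * cross p (S.u (x t) m)) t :=
      (((hk 1).const_mul (p 0)).fun_sub ((hk 0).const_mul (p 1))).const_mul m
    have hd : HasDerivAt (fun t => inner ℝ p (x t)) (inner ℝ p (S.u (x t) m)) t := by
      simp only [inner_eq]
      exact ((hk 0).const_mul (p 0)).fun_add ((hk 1).const_mul (p 1))
    have hpt := hpos t (by rwa [Set.uIcc_of_le hac.le])
    refine ⟨_, ?_, hn.fun_mul (hd.fun_inv hpt.ne')⟩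
    have hu := hS.mul_cross_u_nonpos (hF t hmem)
    -- Quotient rule, with `cross p u * ⟪p, x⟫ - cross p x * ⟪p, u⟫ = ‖p‖ ^ 2 * cross x u`.
    have hid : m * cross p (S.u (x t) m) * (inner ℝ p (x t))⁻¹ +
        m * cross p (x t) * (-inner ℝ p (S.u (x t) m) / inner ℝ p (x t) ^ 2) =
        inner ℝ p p * (m * cross (x t) (S.u (x t) m)) / inner ℝ p (x t) ^ 2 := by
      field_simp
      simp only [inner_eq, cross]
      ring
    rw [hid]
    exact div_nonpos_of_nonpos_of_nonneg
      (mul_nonpos_of_nonneg_of_nonpos real_inner_self_nonneg hu) (sq_nonneg _))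
  simp only [← div_eq_mul_inv] at key
  rw [div_le_div_iff₀ hpc hpa] at key
  -- The same identity turns the comparison of the two tangents into the sign of `cross (x a) (x
  -- c)`.
  have hid : inner ℝ p p * (m * cross (x a) (x c)) =
      m * cross p (x c) * inner ℝ p (x a) - m * cross p (x a) * inner ℝ p (x c) := by
    simp only [inner_eq, cross]
    ring
  have hpp : 0 < inner ℝ p p := real_inner_self_pos.2 (by rintro rfl; simp at hpa)
  exact nonpos_of_mul_nonpos_right (by linarith) hpp

/-- The states from which flowing does not lead to the excluded half-line: the position is off the
half-line, and the sense of motion around an obstacle agrees with the switching strategy. -/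
def Admissible (S : Setup b) (ζ : Plane × ℝ × ℝ) : Prop :=
  ζ.1 ∉ openHalfLine 0 (nu (-1) S.s) ∧ 0 ≤ ζ.2.1 * inner ℝ ζ.1 S.s

/-- Parallel vectors in a common open half-plane cannot be opposite. Pairing `x = l • y` with `p`
dictates the factor `l`. -/
theorem mem_openHalfLine_of_cross_eq_zero {p x y : Plane} (hx : 0 < inner ℝ p x)
    (hy : 0 < inner ℝ p y) (h : cross x y = 0) : x ∈ openHalfLine 0 y := by
  refine ⟨inner ℝ p x / inner ℝ p y, div_pos hx hy, ?_⟩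
  ext k
  rw [zero_add]
  simp only [PiLp.smul_apply, smul_eq_mul]
  field_simp
  simp only [inner_eq]
  unfold cross at h
  fin_cases k
  · simp only [Fin.zero_eta]; linear_combination p 1 * h
  · simp only [Fin.mk_one]; linear_combination (-p 0) * h

/-- Only the position is controlled at the end: the sign condition may be lost during the flow, but
it is needed only where an interval starts. -/
theorem Admissible.flow (hS : S.Standing) (hξ : IsSolution S.closedLoop D ξ) {j : ℕ}
    {a c : ℝ} (ha : (a, j) ∈ D) (hc : (c, j) ∈ D) (hac : a ≤ c) (h : S.Admissible (ξ (a, j))) :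
    (ξ (c, j)).1 ∉ openHalfLine 0 (nu (-1) S.s) := by
  rintro ⟨l, hl, hx⟩
  rw [zero_add] at hx
  by_cases hm : (ξ (a, j)).2.1 = 0
  · have he := position_of_mode_zero hξ ha hc hac hm
    refine h.1 ⟨(Real.exp (S.γ * a))⁻¹ * (Real.exp (S.γ * c) * l), by positivity, ?_⟩
    rw [zero_add, mul_smul, mul_smul, ← hx, he, inv_smul_smul₀ (Real.exp_pos _).ne']
  rcases hac.eq_or_lt with rfl | hac
  · exact h.1 ⟨l, hl, by rw [zero_add, hx]⟩
  obtain ⟨hcr, p, hpa, hpc⟩ := mul_cross_position_nonpos hS hξ ha hc hac hm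
  have hcx : cross (ξ (a, j)).1 (ξ (c, j)).1 = l * inner ℝ (ξ (a, j)).1 S.s := by
    rw [hx, inner_eq]
    simp [cross, nu]
    ring
  have hin : inner ℝ (ξ (a, j)).1 S.s = 0 := by
    have h1 : l * ((ξ (a, j)).2.1 * inner ℝ (ξ (a, j)).1 S.s) ≤ 0 := by
      rw [hcx] at hcr
      linarith
    have h2 := le_antisymm (nonpos_of_mul_nonpos_right h1 hl) h.2
    exact (mul_eq_zero.1 h2).resolve_left hm
  obtain ⟨l', hl', hx'⟩ := mem_openHalfLine_of_cross_eq_zero hpa hpc (by rw [hcx, hin, mul_zero])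
  exact h.1 ⟨l' * l, mul_pos hl' hl, by rw [hx', hx, smul_smul]⟩

/-- Leaving mode `0`, the switching rule supplies the sign; returning to mode `0`, the product
vanishes. -/
theorem Admissible.of_jump {ζ ζ' : Plane × ℝ × ℝ}
    (hx : ζ.1 ∉ openHalfLine 0 (nu (-1) S.s)) (hJ : ζ' ∈ S.closedLoop.jumpMap ζ) :
    S.Admissible ζ' := by
  obtain ⟨h1, h2, -⟩ := hJ
  refine ⟨h1 ▸ hx, ?_⟩
  rw [h1]
  rcases h2 with ⟨-, ⟨h, hs⟩ | ⟨h, hs⟩⟩ | ⟨-, h⟩ <;> rw [h]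
  · linarith
  · linarith
  · simp

end Setup
end HybridNav

theorem lemma3 {b : ℕ} (S : HybridNav.Setup b) (hS : S.Standing) (hsep : S.Separated)
    (D : Set (ℝ × ℕ)) (ξ : ℝ × ℕ → HybridNav.Plane × ℝ × ℝ)
    (hξ : HybridNav.IsSolution S.closedLoop D ξ)
    (t₀ : ℝ) (j₀ : ℕ) (h₀ : (t₀, j₀) ∈ D)
    (hstart : ξ (t₀, j₀) ∈
      (S.Wy S.ra \ HybridNav.openHalfLine 0 (HybridNav.nu (-1) S.s)) ×ˢ
        ({(0 : ℝ)} ×ˢ HybridNav.Setup.indices b)) :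
    ∀ (t : ℝ) (j : ℕ), (t, j) ∈ D → HybridNav.TimeLE (t₀, j₀) (t, j) →
      (ξ (t, j)).1 ∉ HybridNav.openHalfLine 0 (HybridNav.nu (-1) S.s) := by
  intro t j htj hle
  have hD := hξ.timeDomain
  -- When `t₀ < t`, the order on hybrid times does not mention `j`; the structure of the domain
  -- makes it monotone.
  have hj : j₀ ≤ j := by
    rcases hle with hlt | ⟨-, hj⟩
    · by_contra! hj
      exact (hD.le_of_lt hj htj h₀).not_gt hlt
    · exact hj
  have ht : t₀ ≤ t := hle.elim le_of_lt fun h => h.1.le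
  clear hle
  induction j, hj using Nat.le_induction generalizing t with
  | base =>
    have hm : (ξ (t₀, j₀)).2.1 = 0 := hstart.2.1
    refine HybridNav.Setup.Admissible.flow hS hξ h₀ htj ht ⟨hstart.1.2, ?_⟩
    simp [hm]
  | succ j hj ih =>
    -- The induction hypothesis is used at the jump time `s`; the flow then goes from `(s, j + 1)`
    -- to `(t, j + 1)`.
    obtain ⟨s, hst, hsj, hsj', hmax⟩ := hD.exists_jumpTime htj
    have hs : t₀ ≤ s := by
      rcases hj.eq_or_lt with rfl | hlt
      · exact hmax t₀ h₀
      · exact hD.le_of_lt hlt h₀ hsj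
    exact HybridNav.Setup.Admissible.flow hS hξ hsj' htj hst
      (HybridNav.Setup.Admissible.of_jump (ih s hsj hs) (hξ.jump s j hsj hsj').2)
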